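/- Let $d\ge 1$ and let $S\subseteq\mathbb N^d$ be an affine semigroup, i.e. a finitely generated submonoid, with (unique) minimal system of generators $\{a_1,\dots,a_n\}$; the number $n=e(S)$ is its embedding dimension. Let $\mathrm{cone}(S)=\{\sum_i\lambda_i a_i : \lambda_i\in\mathbb Q_{\ge 0}\}$ and $\mathcal H(S)=(\mathrm{cone}(S)\setminus S)\cap\mathbb N^d$. The set of pseudo-Frobenius elements of $S$ is $$\mathrm{PF}(S)=\{f\in\mathcal H(S) : f+s\in S\ \text{for all}\ s\in S\setminus\{0\}\},$$ and its cardinality is called the Betti-type of $S$. For $E\subseteq S$, the Apéry set is $\mathrm{Ap}(S,E)=\{b\in S : b-e\notin S\ \text{for all}\ e\in E\}$. Given a field $k$, regard the semigroup ring $k[S]$ as a module over $R=k[x_1,\dots,x_n]$ via $x_i\mapsto \mathbf t^{a_i}$; $S$ is called an MPD-semigroup (of maximal projective dimension) if $\mathrm{pdim}_R\,k[S]=n-1$. Let $k$ be any field. For an odd integer $a\ge 3$ and an integer $p\ge 1$ put $$S_{a,p}=\langle (a,0),\,(0,a^p),\,(a+2,2),\,(2,2+a^p)\rangle\subseteq\mathbb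 N^2,$$ $$\Delta=\{(a^p(a+2)-(\ell+2)a-2,\ a^p(\ell+2)-2) : \ell\in\mathbb Z,\ 0\le \ell<a^p-1\}.$$ Then: 1. $\mathrm{Ap}(S_{a,p},\{(a,0),(0,a^p)\})=\{\alpha(a+2,2)+\alpha'(2,2+a^p) : \alpha,\alpha'\in\mathbb N,\ \alpha+\alpha'<a^p\}$. 2. $S_{a,p}$ is an MPD-semigroup. 3. $\Delta$ is a set of exactly $a^p-1$ points of $\mathbb N^2$, and $\Delta\subseteq\mathrm{PF}(S_{a,p})$. 4. The Betti-type of $S_{a,p}$ is at least $a^p-1$, while its embedding dimension is $4$. In particular, the Betti-type is not bounded in terms of the embedding dimension: for every $N\in\mathbb N$ there are an odd $a\ge 3$ and a $p\ge 1$ such that the MPD-semigroup $S_{a,p}$ has embedding dimension $4$ and Betti-type at least $N$. -/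

import Mathlib

open CategoryTheory

namespace AffineSemigroup

variable {d : ℕ}

/-- `A` is a minimal system of generators of `S`: it generates `S` and no proper subset does. -/
def IsMinimalGeneratingSet (S : AddSubmonoid (Fin d → ℕ)) (A : Set (Fin d → ℕ)) : Prop :=
  Minimal (fun B : Set (Fin d → ℕ) => AddSubmonoid.closure B = S) A

/-- The minimal system of generators (Hilbert basis) of `S`: the nonzero elements of `S` that are
not a sum of two nonzero elements of `S`. That this is the unique minimal generating set is
`isMinimalGeneratingSet_iff` below. -/
def minimalGenerators (S : AddSubmonoid (Fin d → ℕ)) : Set (Fin d → ℕ) :=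
  {x | x ∈ S ∧ x ≠ 0 ∧ ∀ y ∈ S, ∀ z ∈ S, y + z = x → y = 0 ∨ z = 0}

/-- The embedding dimension `e(S)`. -/
noncomputable def embeddingDim (S : AddSubmonoid (Fin d → ℕ)) : ℕ∞ :=
  (minimalGenerators S).encard

/-- `cone(S)`: the nonnegative rational combinations of elements of `S`. -/
def cone (S : AddSubmonoid (Fin d → ℕ)) : Submodule ℚ≥0 (Fin d → ℚ) :=
  Submodule.span ℚ≥0 ((fun (x : Fin d → ℕ) (i : Fin d) => (x i : ℚ)) '' (S : Set (Fin d → ℕ)))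

/-- `H(S) = (cone(S) \ S) ∩ ℕ^d`. -/
def gaps (S : AddSubmonoid (Fin d → ℕ)) : Set (Fin d → ℕ) :=
  {x | (fun i => (x i : ℚ)) ∈ cone S ∧ x ∉ S}

/-- The set `PF(S)` of pseudo-Frobenius elements. -/
def pseudoFrobenius (S : AddSubmonoid (Fin d → ℕ)) : Set (Fin d → ℕ) :=
  {f | f ∈ gaps S ∧ ∀ s ∈ S, s ≠ 0 → f + s ∈ S}

/-- The Betti-type of `S`: the cardinality of `PF(S)`. -/
noncomputable def bettiType (S : AddSubmonoid (Fin d → ℕ)) : ℕ∞ :=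
  (pseudoFrobenius S).encard

/-- The Apéry set `{b ∈ S | b - e ∉ S for all e ∈ E}`; the difference is taken in `ℤ^d`, so
`b - e ∈ S` means that `b = s + e` for some `s ∈ S`. -/
def apery (S : AddSubmonoid (Fin d → ℕ)) (E : Set (Fin d → ℕ)) : Set (Fin d → ℕ) :=
  {b | b ∈ S ∧ ∀ e ∈ E, ¬ ∃ s ∈ S, s + e = b}

/-- The map `π : k[x_1, …, x_n] → k[S]`, `x_i ↦ t^{a_i}`, attached to elements `a_1, …, a_n`
of `S`. -/
noncomputable def presentation (k : Type*) [Field k] (S : AddSubmonoid (Fin d → ℕ)) {n : ℕ}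
    (g : Fin n → S) : MvPolynomial (Fin n) k →ₐ[k] AddMonoidAlgebra k S :=
  MvPolynomial.aeval fun i => AddMonoidAlgebra.single (g i) (1 : k)

/-- The semigroup ring `k[S]` as a module over `R = k[x_1, …, x_n]` through `π`. -/
noncomputable def semigroupRingModule (k : Type*) [Field k] (S : AddSubmonoid (Fin d → ℕ)) {n : ℕ}
    (g : Fin n → S) : ModuleCat (MvPolynomial (Fin n) k) :=
  (ModuleCat.restrictScalars (presentation k S g).toRingHom).obj
    (ModuleCat.of (AddMonoidAlgebra k S) (AddMonoidAlgebra k S))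

/-- `S` is an MPD-semigroup (over the field `k`): `S` is minimally generated by finitely many
elements `a_1, …, a_n`, and `pdim_R k[S] = n - 1` for `R = k[x_1, …, x_n]`. -/
def IsMPD (k : Type*) [Field k] (S : AddSubmonoid (Fin d → ℕ)) : Prop :=
  ∃ (n : ℕ) (g : Fin n → S), Function.Injective g ∧
    IsMinimalGeneratingSet S (Set.range fun i => (g i : Fin d → ℕ)) ∧
    projectiveDimension (semigroupRingModule k S g) + 1 = n

theorem minimalGenerators_subset {S : AddSubmonoid (Fin d → ℕ)} {A : Set (Fin d → ℕ)}
    (hA : AddSubmonoid.closure A = S) : minimalGenerators S ⊆ A := by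
  intro x hx
  obtain ⟨hxS, hx0, hirr⟩ := hx
  have key : ∀ y ∈ AddSubmonoid.closure A, y ≠ 0 →
      ∃ u ∈ A, ∃ v ∈ AddSubmonoid.closure A, u ≠ 0 ∧ u + v = y := by
    intro y hy
    induction hy using AddSubmonoid.closure_induction with
    | mem y hy => exact fun h => ⟨y, hy, 0, zero_mem _, h, add_zero _⟩
    | zero => exact fun h => absurd rfl h
    | add y z hy hz ihy ihz =>
      intro h
      by_cases hy0 : y = 0
      · subst hy0
        simpa using ihz (by simpa using h)
      · obtain ⟨u, hu, v, hv, hu0, rfl⟩ := ihy hy0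
        exact ⟨u, hu, v + z, add_mem hv hz, hu0, by rw [add_assoc]⟩
  obtain ⟨u, hu, v, hv, hu0, huv⟩ := key x (hA ▸ hxS) hx0
  rcases hirr u (hA ▸ AddSubmonoid.subset_closure hu) v (hA ▸ hv) huv with h | h
  · exact absurd h hu0
  · rw [h, add_zero] at huv
    exact huv ▸ hu

theorem closure_minimalGenerators (S : AddSubmonoid (Fin d → ℕ)) :
    AddSubmonoid.closure (minimalGenerators S) = S := by
  apply le_antisymm
  · rw [AddSubmonoid.closure_le]
    exact fun x hx => hx.1
  · intro x
    induction hm : ∑ i, x i using Nat.strong_induction_on generalizing x with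
    | _ m ih =>
      intro hx
      by_cases h0 : x = 0
      · exact h0 ▸ zero_mem _
      by_cases hirr : ∀ y ∈ S, ∀ z ∈ S, y + z = x → y = 0 ∨ z = 0
      · exact AddSubmonoid.subset_closure ⟨hx, h0, hirr⟩
      · push Not at hirr
        obtain ⟨y, hy, z, hz, rfl, hy0, hz0⟩ := hirr
        have pos : ∀ w : Fin d → ℕ, w ≠ 0 → 0 < ∑ i, w i := by
          intro w hw
          obtain ⟨i, hi⟩ := Function.ne_iff.mp hw
          exact Finset.sum_pos' (fun _ _ => Nat.zero_le _)
            ⟨i, Finset.mem_univ i, Nat.pos_of_ne_zero hi⟩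
        have h1 := pos y hy0
        have h2 := pos z hz0
        simp only [Pi.add_apply, Finset.sum_add_distrib] at hm
        exact add_mem (ih (∑ i, y i) (by omega) rfl hy) (ih (∑ i, z i) (by omega) rfl hz)

theorem isMinimalGeneratingSet_iff (S : AddSubmonoid (Fin d → ℕ)) (A : Set (Fin d → ℕ)) :
    IsMinimalGeneratingSet S A ↔ A = minimalGenerators S := by
  constructor
  · intro h
    exact (h.2 (closure_minimalGenerators S) (minimalGenerators_subset h.1)).antisymm
      (minimalGenerators_subset h.1)
  · rintro rfl
    exact ⟨closure_minimalGenerators S, fun B hB _ => minimalGenerators_subset hB⟩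

/-- `S_{a,p} = ⟨(a,0), (0,a^p), (a+2,2), (2,2+a^p)⟩`. -/
def Sap (a p : ℕ) : AddSubmonoid (Fin 2 → ℕ) :=
  AddSubmonoid.closure {![a, 0], ![0, a ^ p], ![a + 2, 2], ![2, 2 + a ^ p]}

/-- `Δ = {(a^p (a+2) - (ℓ+2) a - 2, a^p (ℓ+2) - 2) | 0 ≤ ℓ < a^p - 1}`, with the coordinates
computed in `ℤ`. -/
def Delta (a p : ℕ) : Set (Fin 2 → ℕ) :=
  {x | ∃ l : ℕ, (l : ℤ) < (a : ℤ) ^ p - 1 ∧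
    (x 0 : ℤ) = (a : ℤ) ^ p * (a + 2) - (l + 2) * a - 2 ∧
    (x 1 : ℤ) = (a : ℤ) ^ p * (l + 2) - 2}

end AffineSemigroup

/-! Combinatorics. Put `q = a ^ p`. Points of `S_{a,p}` are `m (2,2) + i (a,0) + j (0,q)` with `m ≤
i + j`. The basic relation is `q (2,2) = 2 a^(p-1) (a,0) + 2 (0,q)`. Since `2` is invertible modulo
`q`, the representation with `m < q`, when there is one, differs from any other by a multiple of
this relation, and it has the least `m` and the largest `i + j` (`exists_eq_of_repr_eq`). So
membership is tested on that reduced representation. The Apéry set is the case `m = i + j < q`. The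
points of `Δ` have `m = q - 1` and `i + j = q - 2`: they miss `S` by one, and adding any nonzero
element of `S` repairs this.

Projective dimension. For `T ⊆ ℕ^d` stable under translation by the generators, let `k[T]` be the
span of its monomials. It is free over the polynomial ring in one variable, and each further
variable raises the projective dimension by at most one, so with four generators `pdim k[T] ≤ 3`. If
`f` is pseudo-Frobenius, then `S ∪ {f}` is again stable, although it need not be a monoid, and `k[S
∪ {f}] / k[S]` is the residue field `k`. As `pdim k ≥ 4`, the value `pdim k[S] < 3` is impossible.
Hence one element of `PF(S)` makes `S` an MPD-semigroup. -/

section PolynomialResolution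

/-! ### The two-term resolution of an `A[X]`-module by modules extended from `A`. -/

open TensorProduct Polynomial

variable (A M : Type*) [CommRing A] [AddCommGroup M] [Module A M] [Module A[X] M]
  [IsScalarTower A A[X] M]

/-- The map `f ⊗ m ↦ X f ⊗ m - f ⊗ X m`. -/
noncomputable def Polynomial.tensorDiff : A[X] ⊗[A] M →ₗ[A[X]] A[X] ⊗[A] M :=
  (X : A[X]) • LinearMap.id - (Algebra.lsmul A A M (X : A[X])).baseChange A[X]

/-- The action map `f ⊗ m ↦ f m`. -/
noncomputable def Polynomial.tensorAction : A[X] ⊗[A] M →ₗ[A[X]] M :=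
  LinearMap.liftBaseChange A[X] LinearMap.id

variable {A M}

theorem Polynomial.tensorDiff_tmul (f : A[X]) (m : M) :
    tensorDiff A M (f ⊗ₜ m) = (X * f) ⊗ₜ m - f ⊗ₜ ((X : A[X]) • m) := by
  simp [tensorDiff, TensorProduct.smul_tmul']

theorem Polynomial.tensorAction_tmul (f : A[X]) (m : M) :
    tensorAction A M (f ⊗ₜ m) = f • m := by
  simp [tensorAction]

theorem Polynomial.tensorAction_surjective : Function.Surjective (tensorAction A M) :=
  fun m => ⟨1 ⊗ₜ m, by simp [tensorAction_tmul]⟩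

/-- Modulo the range, each factor `X` can be moved across the tensor sign; the differences telescope
in the degree. -/
theorem Polynomial.tmul_sub_mem_range_tensorDiff (f : A[X]) (m : M) :
    f ⊗ₜ m - 1 ⊗ₜ (f • m) ∈ LinearMap.range (tensorDiff A M) := by
  induction f using Polynomial.induction_on' generalizing m with
  | add f g hf hg =>
    have h := add_mem (hf m) (hg m)
    rwa [sub_add_sub_comm, ← TensorProduct.add_tmul, ← TensorProduct.tmul_add, ← add_smul] at h
  | monomial n c =>
    induction n generalizing m with
    | zero =>
      have h : (monomial 0 c : A[X]) = c • 1 := by simp [← C_mul', ← C_mul_X_pow_eq_monomial]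
      rw [h, TensorProduct.smul_tmul, smul_assoc, one_smul, sub_self]
      exact zero_mem _
    | succ n ih =>
      have h : (monomial (n + 1) c : A[X]) = X * monomial n c := by
        rw [X_mul_monomial]
      have h1 := add_mem (LinearMap.mem_range_self (tensorDiff A M) (monomial n c ⊗ₜ m))
        (ih ((X : A[X]) • m))
      rw [tensorDiff_tmul, sub_add_sub_cancel, smul_smul, mul_comm _ X, ← h] at h1
      exact h1

theorem Polynomial.tensorDiff_exact :
    Function.Exact (tensorDiff A M) (tensorAction A M) := by
  intro z
  constructor
  · intro hz
    have key : ∀ z : A[X] ⊗[A] M,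
        z - 1 ⊗ₜ (tensorAction A M z) ∈ LinearMap.range (tensorDiff A M) := by
      intro z
      induction z with
      | zero => simp
      | tmul f m => rw [tensorAction_tmul]; exact tmul_sub_mem_range_tensorDiff f m
      | add x y hx hy =>
        rw [map_add, TensorProduct.tmul_add, add_sub_add_comm]
        exact add_mem hx hy
    have h := key z
    rwa [hz, TensorProduct.tmul_zero, sub_zero] at h
  · rintro ⟨z, rfl⟩
    induction z with
    | zero => simp
    | tmul f m =>
      rw [tensorDiff_tmul, map_sub, tensorAction_tmul, tensorAction_tmul, smul_smul, mul_comm f,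
        sub_self]
    | add x y hx hy => rw [map_add, map_add, hx, hy, add_zero]

theorem Polynomial.tensorDiff_injective : Function.Injective (tensorDiff A M) := by
  classical
  let e := TensorProduct.equivFinsuppOfBasisLeft (N := M) (Polynomial.basisMonomials A)
  -- With `z = ∑ Xⁿ ⊗ zₙ`, this forces `zₙ = X zₙ₊₁` on the kernel, so a nonzero top coefficient
  -- would have a nonzero successor.
  have he : ∀ z n, e (tensorDiff A M z) (n + 1) = e z n - (X : A[X]) • e z (n + 1) := by
    intro z n
    induction z with
    | zero => simp
    | tmul f m =>
      rw [tensorDiff_tmul, map_sub, Finsupp.sub_apply]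
      simp only [e, TensorProduct.equivFinsuppOfBasisLeft_apply_tmul_apply]
      change (X * f).coeff (n + 1) • m - f.coeff (n + 1) • (X : A[X]) • m =
        f.coeff n • m - (X : A[X]) • f.coeff (n + 1) • m
      rw [coeff_X_mul, smul_comm]
    | add x y hx hy =>
      simp only [map_add, Finsupp.add_apply, hx, hy, smul_add]
      abel
  rw [injective_iff_map_eq_zero]
  intro z hz
  by_contra hz0
  have hne : (e z).support.Nonempty := by
    rw [Finsupp.support_nonempty_iff]
    simpa using hz0
  have hmax := Finset.max'_mem _ hne
  set n := (e z).support.max' hne with hn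
  have h1 := he z n
  rw [hz, map_zero, Finsupp.zero_apply, eq_comm, sub_eq_zero] at h1
  have h2 : e z (n + 1) ≠ 0 := by
    intro h
    rw [h, smul_zero] at h1
    exact (Finsupp.mem_support_iff.mp hmax) h1
  have h3 := Finset.le_max' _ _ (Finsupp.mem_support_iff.mpr h2)
  omega

end PolynomialResolution

-- Projective dimension after adjoining a variable.

universe u

open Polynomial in
theorem Polynomial.hasProjectiveDimensionLE_one_of_projective {A : Type u} [CommRing A]
    (M : ModuleCat.{u} A[X]) [Module A M] [IsScalarTower A A[X] M] [Module.Projective A M] :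
    HasProjectiveDimensionLE M 1 := by
  let S : ShortComplex (ModuleCat.{u} A[X]) :=
    ModuleCat.shortComplexOfCompEqZero (tensorDiff A M) (tensorAction A M)
      tensorDiff_exact.linearMap_comp_eq_zero
  have hS : S.ShortExact :=
    { exact := ModuleCat.shortComplex_exact _ tensorDiff_exact
      mono_f := (ModuleCat.mono_iff_injective _).mpr tensorDiff_injective
      epi_g := (ModuleCat.epi_iff_surjective _).mpr tensorAction_surjective }
  have h1 : Projective S.X₁ := (IsProjective.iff_projective _).mp
    (inferInstanceAs (Module.Projective A[X] (TensorProduct A A[X] M)))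
  have h2 : Projective S.X₂ := h1
  exact hS.hasProjectiveDimensionLT_X₃ 1 inferInstance inferInstance

open Polynomial in
theorem Polynomial.projective_restrictScalars_of_free {A : Type u} [CommRing A]
    (M : ModuleCat.{u} A[X]) [Module.Free A[X] M] :
    Projective ((ModuleCat.restrictScalars (C : A →+* A[X])).obj M) := by
  let _ : Module A M := Module.compHom M (C : A →+* A[X])
  have : IsScalarTower A A[X] M := IsScalarTower.of_algebraMap_smul fun _ _ => rfl
  have : Module.Free A M := Module.Free.trans (S := A[X])
  exact (IsProjective.iff_projective _).mp (inferInstanceAs (Module.Projective A M))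

-- Dimension shifting: `A[X]`-free modules restrict to `A`-projective ones, so a syzygy over `A[X]`
-- restricts to a syzygy over `A`. The base case is the two-term resolution.
open Polynomial in
theorem Polynomial.hasProjectiveDimensionLE_succ_of_restrictScalars {A : Type u} [CommRing A]
    (n : ℕ) (M : ModuleCat.{u} A[X])
    (h : HasProjectiveDimensionLE ((ModuleCat.restrictScalars (C : A →+* A[X])).obj M) n) :
    HasProjectiveDimensionLE M (n + 1) := by
  induction n generalizing M with
  | zero =>
    let _ : Module A M := Module.compHom M (C : A →+* A[X])
    have : IsScalarTower A A[X] M := IsScalarTower.of_algebraMap_smul fun _ _ => rfl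
    have : Module.Projective A M :=
      (IsProjective.iff_projective _).mpr ((projective_iff_hasProjectiveDimensionLE_zero _).mpr h)
    exact hasProjectiveDimensionLE_one_of_projective M
  | succ n ih =>
    let S := M.projectiveShortComplex
    have hS : S.ShortExact := M.shortExact_projectiveShortComplex
    have hS' : (S.map (ModuleCat.restrictScalars (C : A →+* A[X]))).ShortExact :=
      hS.map_of_exact _
    have hP : Projective (S.map (ModuleCat.restrictScalars (C : A →+* A[X]))).X₂ := by
      exact projective_restrictScalars_of_free S.X₂
    rw [HasProjectiveDimensionLE, hS.hasProjectiveDimensionLT_X₃_iff (n + 1) inferInstance]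
    exact ih _ ((hS'.hasProjectiveDimensionLT_X₃_iff n hP).mp h)

/-- Adjoining one variable raises the projective dimension of a module by at most one. -/
theorem MvPolynomial.hasProjectiveDimensionLE_succ_of_restrictScalars {k : Type u} [CommRing k]
    {n : ℕ} (m : ℕ) (M : ModuleCat.{u} (MvPolynomial (Fin (n + 1)) k))
    (h : HasProjectiveDimensionLE ((ModuleCat.restrictScalars
      (rename Fin.succ : MvPolynomial (Fin n) k →ₐ[k] MvPolynomial (Fin (n + 1)) k).toRingHom).obj
        M) m) :
    HasProjectiveDimensionLE M (m + 1) := by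
  let e := (finSuccEquiv k n).toRingEquiv
  let N : ModuleCat.{u} (Polynomial (MvPolynomial (Fin n) k)) :=
    (ModuleCat.restrictScalars e.symm.toRingHom).obj M
  -- The adjoined variable is the one of index `0`; the old ones are shifted up by `Fin.succ`.
  have hC : ∀ r : MvPolynomial (Fin n) k, e.symm (Polynomial.C r) = rename Fin.succ r := by
    intro r
    rw [RingEquiv.symm_apply_eq]
    induction r using MvPolynomial.induction_on with
    | C c => simp [e, finSuccEquiv_apply]
    | add p q hp hq => simp [hp, hq]
    | mul_X p i hp => simp [hp, e, finSuccEquiv_X_succ]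
  have hN : HasProjectiveDimensionLE ((ModuleCat.restrictScalars Polynomial.C).obj N) m := by
    let f : (ModuleCat.restrictScalars
        (rename Fin.succ : MvPolynomial (Fin n) k →ₐ[k]
          MvPolynomial (Fin (n + 1)) k).toRingHom).obj M →ₗ[MvPolynomial (Fin n) k]
        (ModuleCat.restrictScalars Polynomial.C).obj N := ⟨⟨fun x => x, fun _ _ => rfl⟩, ?_⟩
    · exact ModuleCat.hasProjectiveDimensionLE_of_linearEquiv
        (LinearEquiv.ofBijective f Function.bijective_id) m
    intro r x
    change (rename Fin.succ r) • (x : M) = e.symm (Polynomial.C r) • (x : M)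
    rw [hC]
  have hN' := Polynomial.hasProjectiveDimensionLE_succ_of_restrictScalars m N hN
  let _ := RingHomInvPair.of_ringEquiv e.symm
  let _ := RingHomInvPair.of_ringEquiv e.symm.symm
  refine ModuleCat.hasProjectiveDimensionLE_of_semiLinearEquiv (M := N) e.symm ?_ (m + 1)
  exact LinearEquiv.ofBijective (⟨⟨id, fun _ _ => rfl⟩, fun r x => rfl⟩) Function.bijective_id

/-! ### Vanishing of `Ext` along a regular sequence. -/

section RegularSequenceExt

open Abelian

variable {R : Type u} [CommRing R] (K : ModuleCat.{u} R)

/-- Multiplication by `x` on `Ext` may be computed on either argument, and it is zero on `K`. -/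
theorem ModuleCat.ext_comp_smul_id_eq_zero {x : R} (hK : ∀ y : K, x • y = 0) (N : ModuleCat.{u} R)
    {i : ℕ} (z : Ext K N i) : z.comp (Ext.mk₀ (x • 𝟙 N)) (add_zero i) = 0 := by
  have h : x • 𝟙 K = 0 := by ext y; exact hK y
  calc z.comp (Ext.mk₀ (x • 𝟙 N)) (add_zero i)
      = (Ext.mk₀ (x • 𝟙 K)).comp z (zero_add i) := by
        rw [Ext.mk₀_smul, Ext.mk₀_smul, Ext.comp_smul, Ext.smul_comp, Ext.comp_mk₀_id,
          Ext.mk₀_id_comp]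
    _ = 0 := by rw [h, Ext.mk₀_zero, Ext.zero_comp]

variable {N N' : ModuleCat.{u} R} {x : R} {g : N ⟶ N'} {w : (x • 𝟙 N) ≫ g = 0}

theorem ModuleCat.subsingleton_ext_zero_of_smul (hK : ∀ y : K, x • y = 0)
    (hS : (ShortComplex.mk (x • 𝟙 N) g w).ShortExact) : Subsingleton (Ext K N 0) := by
  rw [Ext.homEquiv₀.subsingleton_congr]
  refine ⟨fun f f' => ?_⟩
  have := hS.mono_f
  rw [← cancel_mono (x • 𝟙 N)]
  ext y
  change x • f y = x • f' y
  rw [← map_smul, ← map_smul, hK, map_zero, map_zero]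

theorem ModuleCat.subsingleton_ext_succ_of_quotient (hK : ∀ y : K, x • y = 0)
    (hS : (ShortComplex.mk (x • 𝟙 N) g w).ShortExact) (i : ℕ) (h : Subsingleton (Ext K N' i)) :
    Subsingleton (Ext K N (i + 1)) := by
  refine subsingleton_of_forall_eq 0 fun z => ?_
  obtain ⟨y, rfl⟩ := Ext.covariant_sequence_exact₁ K hS z (ext_comp_smul_id_eq_zero K hK N z) rfl
  rw [@Subsingleton.elim _ h y 0, Ext.zero_comp]

theorem ModuleCat.subsingleton_ext_quotient
    (hS : (ShortComplex.mk (x • 𝟙 N) g w).ShortExact) (i : ℕ) (h : Subsingleton (Ext K N i))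
    (h' : Subsingleton (Ext K N (i + 1))) : Subsingleton (Ext K N' i) := by
  refine subsingleton_of_forall_eq 0 fun z => ?_
  obtain ⟨y, rfl⟩ := Ext.covariant_sequence_exact₃ K hS z rfl (@Subsingleton.elim _ h' _ _)
  rw [@Subsingleton.elim _ h y 0, Ext.zero_comp]

/-- If `N 0, N 1, …, N n` are the successive quotients by a regular sequence annihilating `K`, and
`K` has projective dimension less than `n`, then there are no nonzero maps `K ⟶ N n`. -/
theorem ModuleCat.subsingleton_hom_of_hasProjectiveDimensionLT (n : ℕ) (N : ℕ → ModuleCat.{u} R)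
    (x : ℕ → R) (hK : ∀ j < n, ∀ y : K, x j • y = 0) (g : ∀ j, N j ⟶ N (j + 1))
    (w : ∀ j, (x j • 𝟙 (N j)) ≫ g j = 0)
    (hS : ∀ j < n, (ShortComplex.mk (x j • 𝟙 (N j)) (g j) (w j)).ShortExact)
    (h : HasProjectiveDimensionLT K n) : Subsingleton (K ⟶ N n) := by
  have low : ∀ i j, i + j < n → Subsingleton (Ext K (N j) i) := by
    intro i
    induction i with
    | zero => exact fun j hj => subsingleton_ext_zero_of_smul K (hK j (by omega)) (hS j (by omega))
    | succ i ih =>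
      exact fun j hj => subsingleton_ext_succ_of_quotient K (hK j (by omega)) (hS j (by omega)) i
        (ih (j + 1) (by omega))
  -- The bound on `pdim K` kills `Ext^n(K, N 0)`. Exactness of `Ext^i(K, N j) → Ext^i(K, N (j+1)) →
  -- Ext^(i+1)(K, N j)` carries this along the antidiagonal to `Hom(K, N n)`; `low` kills the left
  -- term.
  have diag : ∀ j i, i + j = n → Subsingleton (Ext K (N j) i) := by
    intro j
    induction j with
    | zero => exact fun i hi => h.subsingleton K n i (by omega) _
    | succ j ih =>
      exact fun i hi => subsingleton_ext_quotient K (hS j (by omega)) i (low i j (by omega))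
        (ih (i + 1) (by omega))
  exact Ext.homEquiv₀.subsingleton_congr.mp (diag n 0 (by omega))

end RegularSequenceExt

/-! ### The residue field has projective dimension at least the number of variables. -/

section ResidueField

open MvPolynomial

variable (k : Type u) [Field k] (n : ℕ)

/-- The residue field `k` at the origin, as a module over `k[x_1, …, x_n]`. -/
noncomputable def MvPolynomial.residueModule : ModuleCat.{u} (MvPolynomial (Fin n) k) :=
  (ModuleCat.restrictScalars (constantCoeff : MvPolynomial (Fin n) k →+* k)).obj
    (ModuleCat.of k k)

/-- The ideal generated by the first `j` variables. -/
noncomputable def MvPolynomial.idealFirstVars (j : ℕ) : Ideal (MvPolynomial (Fin n) k) :=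
  Ideal.span (X '' {i | i.1 < j})

variable {k n}

/-- Membership in a monomial ideal is read off exponents, and `X j` alters only the exponent of
index `j`, which is not among the first `j`. -/
theorem MvPolynomial.X_mul_mem_idealFirstVars {j : ℕ} (hj : j < n) {f : MvPolynomial (Fin n) k}
    (h : X ⟨j, hj⟩ * f ∈ idealFirstVars k n j) : f ∈ idealFirstVars k n j := by
  rw [idealFirstVars, mem_ideal_span_X_image] at h ⊢
  intro m hm
  obtain ⟨i, hi, hi'⟩ := h (Finsupp.single ⟨j, hj⟩ 1 + m) (by
    rw [mem_support_iff] at hm ⊢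
    rwa [add_comm, mul_comm, coeff_mul_X])
  refine ⟨i, hi, ?_⟩
  have : (⟨j, hj⟩ : Fin n) ≠ i := by
    rintro rfl
    exact lt_irrefl j hi
  simpa [Finsupp.single_apply, this] using hi'

theorem MvPolynomial.idealFirstVars_succ {j : ℕ} (hj : j < n) :
    idealFirstVars k n (j + 1) = Ideal.span {X ⟨j, hj⟩} ⊔ idealFirstVars k n j := by
  rw [idealFirstVars, idealFirstVars, ← Ideal.span_union]
  congr 1
  rw [← Set.image_singleton, ← Set.image_union]
  congr 1
  ext i
  simp [Fin.ext_iff]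
  omega

/-- The variables form a regular sequence annihilating `k`, yet the constants give a nonzero map
from `k` to the quotient by all of them. -/
theorem MvPolynomial.not_hasProjectiveDimensionLT_residueModule :
    ¬ HasProjectiveDimensionLT (residueModule k n) n := by
  intro h
  -- The value `0` beyond `n` is a filler that keeps `x j` in the next ideal; regularity is needed
  -- only for `j < n`.
  let x : ℕ → MvPolynomial (Fin n) k := fun j => if hj : j < n then X ⟨j, hj⟩ else 0
  have hx : ∀ j (hj : j < n), x j = X ⟨j, hj⟩ := fun j hj => dif_pos hj
  have hle : ∀ j, idealFirstVars k n j ≤ idealFirstVars k n (j + 1) := fun j =>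
    Ideal.span_mono (Set.image_mono fun i (hi : i.1 < j) => Nat.lt_succ_of_lt hi)
  have hmem : ∀ j, x j ∈ idealFirstVars k n (j + 1) := by
    intro j
    by_cases hj : j < n
    · rw [hx j hj]
      exact Ideal.subset_span ⟨⟨j, hj⟩, Nat.lt_succ_self j, rfl⟩
    · simp [x, hj]
  let N : ℕ → ModuleCat.{u} (MvPolynomial (Fin n) k) := fun j =>
    ModuleCat.of _ (MvPolynomial (Fin n) k ⧸ idealFirstVars k n j)
  let g : ∀ j, N j ⟶ N (j + 1) := fun j =>
    ModuleCat.ofHom (Submodule.factor (hle j))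
  have w : ∀ j, (x j • 𝟙 (N j)) ≫ g j = 0 := by
    intro j
    refine ModuleCat.hom_ext (LinearMap.ext fun y => ?_)
    obtain ⟨y, rfl⟩ := Submodule.mkQ_surjective _ y
    change Submodule.Quotient.mk (x j • y) = 0
    rw [Submodule.Quotient.mk_eq_zero]
    exact Ideal.mul_mem_right _ _ (hmem j)
  have hS : ∀ j < n, (ShortComplex.mk (x j • 𝟙 (N j)) (g j) (w j)).ShortExact := by
    intro j hj
    refine { exact := ?_, mono_f := ?_, epi_g := ?_ }
    · rw [ShortComplex.ShortExact.moduleCat_exact_iff_function_exact]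
      intro y
      refine ⟨fun hy => ?_, ?_⟩
      · obtain ⟨y, rfl⟩ := Submodule.mkQ_surjective _ y
        have hy' : y ∈ idealFirstVars k n (j + 1) := (Submodule.Quotient.mk_eq_zero _).mp hy
        rw [idealFirstVars_succ hj, Submodule.mem_sup] at hy'
        obtain ⟨u, hu, v, hv, rfl⟩ := hy'
        obtain ⟨c, rfl⟩ := Ideal.mem_span_singleton.mp hu
        refine ⟨Submodule.Quotient.mk c, ?_⟩
        change Submodule.Quotient.mk (x j • c) = Submodule.Quotient.mk _
        rw [Submodule.Quotient.eq, hx j hj, smul_eq_mul, sub_add_cancel_left]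
        exact neg_mem hv
      · rintro ⟨z, rfl⟩
        exact congrArg (fun f => f.hom z) (w j)
    · rw [ModuleCat.mono_iff_injective, injective_iff_map_eq_zero]
      intro y hy
      obtain ⟨y, rfl⟩ := Submodule.mkQ_surjective _ y
      have hy' : x j • y ∈ idealFirstVars k n j := (Submodule.Quotient.mk_eq_zero _).mp hy
      rw [hx j hj] at hy'
      exact (Submodule.Quotient.mk_eq_zero _).mpr (X_mul_mem_idealFirstVars hj hy')
    · rw [ModuleCat.epi_iff_surjective]
      intro y
      obtain ⟨y, rfl⟩ := Submodule.mkQ_surjective _ y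
      exact ⟨Submodule.Quotient.mk y, rfl⟩
  have hsub := ModuleCat.subsingleton_hom_of_hasProjectiveDimensionLT (residueModule k n) n N x
    (fun j hj y => by
      change constantCoeff (x j) • (show k from y) = 0
      rw [hx j hj, constantCoeff_X, zero_smul]) g w hS h
  let φ : residueModule k n →ₗ[MvPolynomial (Fin n) k]
      (MvPolynomial (Fin n) k ⧸ idealFirstVars k n n) :=
    { toFun := fun c => Submodule.Quotient.mk (C (show k from c))
      map_add' := fun c d => by
        rw [← Submodule.Quotient.mk_add, ← C_add]
        rfl
      map_smul' := fun r c => by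
        change Submodule.Quotient.mk (C (constantCoeff r * (show k from c))) =
          r • Submodule.Quotient.mk (C (show k from c))
        rw [← Submodule.Quotient.mk_smul, Submodule.Quotient.eq, C_mul, smul_eq_mul, ← sub_mul]
        refine Ideal.mul_mem_right _ _ ?_
        rw [idealFirstVars, mem_ideal_span_X_image]
        intro m hm
        by_contra! hm'
        have hm0 : m = 0 := by
          ext i
          exact hm' i i.2
        rw [mem_support_iff, hm0] at hm
        simp [constantCoeff_eq] at hm }
  have hφ : φ (show k from 1) = 0 := by
    have h0 : ModuleCat.ofHom φ = 0 := hsub.elim _ _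
    exact congrArg (fun f => f.hom (show k from 1)) h0
  have hmem1 : (C 1 : MvPolynomial (Fin n) k) ∈ idealFirstVars k n n :=
    (Submodule.Quotient.mk_eq_zero _).mp hφ
  rw [idealFirstVars, mem_ideal_span_X_image] at hmem1
  obtain ⟨i, -, hi⟩ := hmem1 0 (by simp)
  exact hi rfl

end ResidueField

/-! ### Freeness over one variable from orbits of a translation. -/

section Shift

open MvPolynomial

/-- A module over `k[y]` with a `k`-basis that decomposes into free orbits of `y` is free. -/
theorem MvPolynomial.free_of_shift_basis {k N : Type*} [Field k] [AddCommGroup N]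
    [Module (MvPolynomial (Fin 1) k) N] {T κ : Type*} (ψ : N ≃+ (T →₀ k))
    (hψ : ∀ c x, ψ ((C c : MvPolynomial (Fin 1) k) • x) = c • ψ x) (E : κ × ℕ ≃ T)
    (hE : ∀ w n, (X 0 : MvPolynomial (Fin 1) k) • ψ.symm (Finsupp.single (E (w, n)) 1) =
      ψ.symm (Finsupp.single (E (w, n + 1)) 1)) :
    Module.Free (MvPolynomial (Fin 1) k) N := by
  let _ : Module k N := Module.compHom N (C : k →+* MvPolynomial (Fin 1) k)
  have : IsScalarTower k (MvPolynomial (Fin 1) k) N :=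
    IsScalarTower.of_algebraMap_smul fun _ _ => rfl
  let b : Module.Basis (κ × ℕ) k N :=
    (Module.Basis.ofRepr (ψ.toLinearEquiv hψ)).reindex E.symm
  have hb : ∀ i, b i = ψ.symm (Finsupp.single (E i) 1) := fun i => by
    simp only [b, Module.Basis.reindex_apply, Equiv.symm_symm]
    rfl
  let c : Module.Basis (Σ _ : κ, Fin 1 →₀ ℕ) k (κ →₀ MvPolynomial (Fin 1) k) :=
    Finsupp.basis fun _ => basisMonomials (Fin 1) k
  let σ : (Σ _ : κ, Fin 1 →₀ ℕ) ≃ κ × ℕ :=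
    (Equiv.sigmaEquivProd κ (Fin 1 →₀ ℕ)).trans
      ((Equiv.refl κ).prodCongr (Finsupp.equivFunOnFinite.trans (Equiv.funUnique (Fin 1) ℕ)))
  let L : (κ →₀ MvPolynomial (Fin 1) k) →ₗ[MvPolynomial (Fin 1) k] N :=
    Finsupp.linearCombination _ fun w => b (w, 0)
  have hpow : ∀ w n, (X 0 ^ n : MvPolynomial (Fin 1) k) • b (w, 0) = b (w, n) := by
    intro w n
    induction n with
    | zero => simp
    | succ n ih => rw [pow_succ', mul_smul, ih, hb, hE, hb]
  have hL : L.restrictScalars k = (c.equiv b σ : _ →ₗ[k] N) := by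
    -- `L` carries the `k`-basis `X^n e_w` to the `k`-basis `b (w, n)`, hence is bijective.
    refine c.ext fun ⟨w, m⟩ => ?_
    have hm : m = Finsupp.single 0 (m 0) := by
      refine Finsupp.ext fun i => ?_
      rw [Subsingleton.elim i 0, Finsupp.single_eq_same]
    have hc : c ⟨w, m⟩ = Finsupp.single w (X 0 ^ m 0) := by
      simp only [c, Finsupp.coe_basis, coe_basisMonomials, X_pow_eq_monomial]
      rw [← hm]
    simp only [LinearMap.coe_restrictScalars, LinearEquiv.coe_coe, Module.Basis.equiv_apply]
    rw [hc, Finsupp.linearCombination_single, hpow]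
    rfl
  have hbij : Function.Bijective L := by
    have h := (c.equiv b σ).bijective
    have h' : (L : _ → N) = c.equiv b σ := congrArg (fun f : _ →ₗ[k] N => (f : _ → N)) hL
    rw [h']
    exact h
  exact Module.Free.of_equiv (LinearEquiv.ofBijective L hbij)

variable {d : ℕ}

/-- A subset of `ℕ^d` stable under translation by `e ≠ 0` is a disjoint union of translates of
`ℕ e`. -/
theorem exists_equiv_prod_nat_of_add_mem {T : Set (Fin d → ℕ)} {e : Fin d → ℕ} (he : e ≠ 0)
    (hT : ∀ t ∈ T, e + t ∈ T) :
    ∃ (κ : Type) (E : κ × ℕ ≃ T), ∀ w n, (E (w, n + 1) : Fin d → ℕ) = e + E (w, n) := by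
  have hmem : ∀ t ∈ T, ∀ n : ℕ, n • e + t ∈ T := by
    intro t ht n
    induction n with
    | zero => simpa
    | succ n ih =>
      rw [succ_nsmul', add_assoc]
      exact hT _ ih
  -- The starting points of the orbits. Every point descends to one, because subtracting `e` lowers
  -- the coordinate sum.
  let κ := {t : Fin d → ℕ // t ∈ T ∧ ∀ s ∈ T, e + s ≠ t}
  let F : κ × ℕ → T := fun x => ⟨x.2 • e + x.1.1, hmem _ x.1.2.1 _⟩
  have hlt : ∀ (w w' : κ) (n m : ℕ), n • e + w.1 = (n + m + 1) • e + w'.1 → False := by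
    intro w w' n m h
    have h' : e + (m • e + w'.1) = w.1 := by
      apply add_left_cancel (a := n • e)
      rw [h]
      module
    exact w.2.2 _ (hmem _ w'.2.1 m) h'
  have hinj : Function.Injective F := by
    rintro ⟨w, n⟩ ⟨w', n'⟩ h
    have h : n • e + w.1 = n' • e + w'.1 := congrArg Subtype.val h
    rcases lt_trichotomy n n' with hn | rfl | hn
    · obtain ⟨m, rfl⟩ := Nat.exists_eq_add_of_lt hn
      exact (hlt _ _ _ _ h).elim
    · rw [Subtype.ext (add_left_cancel h)]
    · obtain ⟨m, rfl⟩ := Nat.exists_eq_add_of_lt hn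
      exact (hlt _ _ _ _ h.symm).elim
  have hpos : 0 < ∑ i, e i := by
    obtain ⟨i, hi⟩ := Function.ne_iff.mp he
    exact Finset.sum_pos' (fun _ _ => Nat.zero_le _)
      ⟨i, Finset.mem_univ i, Nat.pos_of_ne_zero hi⟩
  have hsurj : ∀ m, ∀ t : T, ∑ i, t.1 i = m → ∃ x, F x = t := by
    intro m
    induction m using Nat.strong_induction_on with
    | _ m ih =>
      rintro ⟨t, ht⟩ hm
      by_cases h : ∀ s ∈ T, e + s ≠ t
      · exact ⟨(⟨t, ht, h⟩, 0), Subtype.ext (by simp [F])⟩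
      · push Not at h
        obtain ⟨s, hs, rfl⟩ := h
        simp only [Pi.add_apply, Finset.sum_add_distrib] at hm
        obtain ⟨⟨w, n⟩, hw⟩ := ih (∑ i, s i) (by omega) ⟨s, hs⟩ rfl
        have hw : n • e + w.1 = s := congrArg Subtype.val hw
        refine ⟨(w, n + 1), Subtype.ext ?_⟩
        change (n + 1) • e + w.1 = e + s
        rw [← hw]
        module
  refine ⟨κ, Equiv.ofBijective F ⟨hinj, fun t => hsurj _ t rfl⟩, fun w n => ?_⟩
  change (n + 1) • e + w.1 = e + (n • e + w.1)
  module

end Shift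

/-! ### Monomial modules and the projective dimension of `k[S]`. -/

namespace AffineSemigroup

open MvPolynomial

variable {d n : ℕ} (k : Type u) [Field k] (g : Fin n → Fin d → ℕ)

/-- `k[ℕ^d]` as a module over `k[x_1, …, x_n]` through `x_i ↦ t^{g_i}`. -/
noncomputable def ambientModule : ModuleCat.{u} (MvPolynomial (Fin n) k) :=
  (ModuleCat.restrictScalars (aeval fun i => AddMonoidAlgebra.single (g i) (1 : k) :
      MvPolynomial (Fin n) k →ₐ[k] AddMonoidAlgebra k (Fin d → ℕ)).toRingHom).obj
    (ModuleCat.of (AddMonoidAlgebra k (Fin d → ℕ)) (AddMonoidAlgebra k (Fin d → ℕ)))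

variable {k g}

/-- The coefficients of an element of `ambientModule`. -/
noncomputable def ambientCoeff : ambientModule k g ≃+ ((Fin d → ℕ) →₀ k) :=
  AddMonoidAlgebra.coeffAddEquiv

theorem ambientCoeff_C_smul (c : k) (f : ambientModule k g) :
    ambientCoeff ((C c : MvPolynomial (Fin n) k) • f) = c • ambientCoeff f := by
  change (aeval _ (C c) * (show AddMonoidAlgebra k (Fin d → ℕ) from f)).coeff = c • _
  rw [aeval_C, ← Algebra.smul_def]
  rfl

theorem X_smul_ambientModule (i : Fin n) (f : ambientModule k g) :
    (X i : MvPolynomial (Fin n) k) • f =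
      (AddMonoidAlgebra.single (g i) 1 * (show AddMonoidAlgebra k (Fin d → ℕ) from f) :) := by
  change (aeval _ (X i) * (show AddMonoidAlgebra k (Fin d → ℕ) from f)) = _
  rw [aeval_X]

theorem ambientCoeff_X_smul_add (i : Fin n) (f : ambientModule k g) (t : Fin d → ℕ) :
    ambientCoeff ((X i : MvPolynomial (Fin n) k) • f) (g i + t) = ambientCoeff f t := by
  rw [X_smul_ambientModule]
  refine (AddMonoidAlgebra.coeff_single_mul_eq_mul_coeff t ?_).trans (one_mul _)
  simp

theorem ambientCoeff_X_smul_eq_zero (i : Fin n) (f : ambientModule k g) (s : Fin d → ℕ)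
    (hs : ∀ t, g i + t ≠ s) : ambientCoeff ((X i : MvPolynomial (Fin n) k) • f) s = 0 := by
  rw [X_smul_ambientModule]
  exact AddMonoidAlgebra.coeff_single_mul_of_forall_add_ne _ _ hs

theorem X_smul_ambientCoeff_symm_single (i : Fin n) (t : Fin d → ℕ) (c : k) :
    (X i : MvPolynomial (Fin n) k) • ((ambientCoeff (g := g)).symm (Finsupp.single t c)) =
      ambientCoeff.symm (Finsupp.single (g i + t) c) := by
  rw [X_smul_ambientModule]
  exact (AddMonoidAlgebra.single_mul_single _ _ _ _).trans (by rw [one_mul]; rfl)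

variable (k g) in
/-- The submodule of `k[ℕ^d]` spanned by the monomials with exponents in `T`. -/
noncomputable def monomialSubmodule (T : Set (Fin d → ℕ)) (hT : ∀ i, ∀ t ∈ T, g i + t ∈ T) :
    Submodule (MvPolynomial (Fin n) k) (ambientModule k g) where
  carrier := {f | ∀ s, s ∉ T → ambientCoeff f s = 0}
  zero_mem' := fun s _ => by rw [map_zero]; rfl
  add_mem' := fun {f f'} hf hf' s hs => by
    rw [map_add, Finsupp.add_apply, hf s hs, hf' s hs, add_zero]
  smul_mem' := fun r f hf => by
    change ∀ s, s ∉ T → ambientCoeff f s = 0 at hf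
    change ∀ s, s ∉ T → ambientCoeff (r • f) s = 0
    induction r using MvPolynomial.induction_on generalizing f with
    | C c =>
      intro s hs
      rw [ambientCoeff_C_smul, Finsupp.smul_apply, hf s hs, smul_zero]
    | add p q hp hq =>
      intro s hs
      rw [add_smul, map_add, Finsupp.add_apply, hp f hf s hs, hq f hf s hs, add_zero]
    | mul_X p i hp =>
      rw [mul_smul]
      refine hp _ fun s hs => ?_
      by_cases h : ∃ t, g i + t = s
      · obtain ⟨t, rfl⟩ := h
        rw [ambientCoeff_X_smul_add]
        exact hf t fun ht => hs (hT i t ht)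
      · push Not at h
        exact ambientCoeff_X_smul_eq_zero i f s h

/-- The coordinates of an element of `monomialSubmodule` with respect to the monomials. -/
noncomputable def monomialSubmoduleCoeff (T : Set (Fin d → ℕ)) (hT : ∀ i, ∀ t ∈ T, g i + t ∈ T) :
    monomialSubmodule k g T hT ≃+ (T →₀ k) :=
  AddEquiv.ofBijective
    ((Finsupp.subtypeDomainAddMonoidHom (p := (· ∈ T))).comp
      (ambientCoeff.toAddMonoidHom.comp (monomialSubmodule k g T hT).subtype.toAddMonoidHom)) <| by
    constructor
    · rw [injective_iff_map_eq_zero]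
      rintro ⟨f, hf⟩ h
      rw [Submodule.mk_eq_zero, ← map_eq_zero_iff _ (ambientCoeff (k := k) (g := g)).injective]
      ext s
      by_cases hs : s ∈ T
      · exact DFunLike.congr_fun h ⟨s, hs⟩
      · exact hf s hs
    · intro h
      refine ⟨⟨ambientCoeff.symm (h.mapDomain Subtype.val), fun s hs => ?_⟩, ?_⟩
      · rw [AddEquiv.apply_symm_apply]
        exact Finsupp.mapDomain_of_notMem_range _ _ (by simpa using hs)
      · ext s
        change ambientCoeff ((ambientCoeff (g := g)).symm (h.mapDomain Subtype.val)) s = _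
        rw [AddEquiv.apply_symm_apply, Finsupp.mapDomain_apply Subtype.val_injective]

theorem monomialSubmoduleCoeff_apply {T : Set (Fin d → ℕ)} {hT : ∀ i, ∀ t ∈ T, g i + t ∈ T}
    (f : monomialSubmodule k g T hT) (t : T) :
    monomialSubmoduleCoeff T hT f t = ambientCoeff (f : ambientModule k g) t := rfl

theorem coe_monomialSubmoduleCoeff_symm_single {T : Set (Fin d → ℕ)}
    {hT : ∀ i, ∀ t ∈ T, g i + t ∈ T} (t : T) (c : k) :
    ((monomialSubmoduleCoeff T hT).symm (Finsupp.single t c) : ambientModule k g) =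
      ambientCoeff.symm (Finsupp.single (t : Fin d → ℕ) c) := by
  have hmem : ambientCoeff.symm (Finsupp.single (t : Fin d → ℕ) c) ∈
      monomialSubmodule k g T hT := by
    intro s hs
    rw [AddEquiv.apply_symm_apply, Finsupp.single_eq_of_ne]
    rintro rfl
    exact hs t.2
  have h : (monomialSubmoduleCoeff T hT).symm (Finsupp.single t c) = ⟨_, hmem⟩ := by
    rw [AddEquiv.symm_apply_eq]
    ext s
    rw [monomialSubmoduleCoeff_apply, AddEquiv.apply_symm_apply]
    classical
    simp [Finsupp.single_apply, Subtype.ext_iff]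
  rw [h]

theorem hasProjectiveDimensionLE_monomialSubmodule (g : Fin 4 → Fin d → ℕ) (hg : g 3 ≠ 0)
    (T : Set (Fin d → ℕ)) (hT : ∀ i, ∀ t ∈ T, g i + t ∈ T) :
    HasProjectiveDimensionLE (ModuleCat.of (MvPolynomial (Fin 4) k) (monomialSubmodule k g T hT)) 3 := by
  -- Each restriction drops the variable of index `0`, so after three of them only `X 3` remains;
  -- this is why `g 3 ≠ 0` is the relevant condition.
  refine hasProjectiveDimensionLE_succ_of_restrictScalars 2 _ ?_
  refine hasProjectiveDimensionLE_succ_of_restrictScalars 1 _ ?_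
  refine hasProjectiveDimensionLE_succ_of_restrictScalars 0 _ ?_
  rw [← projective_iff_hasProjectiveDimensionLE_zero, ← IsProjective.iff_projective]
  obtain ⟨κ, E, hE⟩ := exists_equiv_prod_nat_of_add_mem hg (hT 3)
  refine @Module.Projective.of_free _ _ _ _ _ ?_
  refine MvPolynomial.free_of_shift_basis (monomialSubmoduleCoeff T hT) ?_ E ?_
  · intro c x
    ext t
    have h : ∀ y : monomialSubmodule k g T hT, monomialSubmoduleCoeff T hT
        ((C c : MvPolynomial (Fin 4) k) • y) t = c • monomialSubmoduleCoeff T hT y t := by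
      intro y
      rw [monomialSubmoduleCoeff_apply, Submodule.coe_smul, ambientCoeff_C_smul]
      rfl
    refine Eq.trans ?_ (h x)
    congr 2
    change (rename Fin.succ (rename Fin.succ (rename Fin.succ (C c))) : MvPolynomial (Fin 4) k) •
      (show monomialSubmodule k g T hT from x) = _
    simp only [rename_C]
  · intro w m
    have h : (X 3 : MvPolynomial (Fin 4) k) •
        (monomialSubmoduleCoeff T hT).symm (Finsupp.single (E (w, m)) (1 : k)) =
        (monomialSubmoduleCoeff T hT).symm (Finsupp.single (E (w, m + 1)) (1 : k)) := by
      ext1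
      rw [Submodule.coe_smul, coe_monomialSubmoduleCoeff_symm_single,
        coe_monomialSubmoduleCoeff_symm_single, X_smul_ambientCoeff_symm_single, hE]
    refine Eq.trans ?_ h
    change (rename Fin.succ (rename Fin.succ (rename Fin.succ (X 0))) : MvPolynomial (Fin 4) k) •
      (monomialSubmoduleCoeff T hT).symm (Finsupp.single (E (w, m)) (1 : k)) = _
    simp only [rename_X]
    rfl

/-- If `f ∉ T` and `T ∪ {f}` is obtained from `T` by adding a single point which every `g_i`
translates into `T`, then `k` is the quotient of the associated modules; so `k[T]` has projective
dimension at least `3`. -/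
theorem not_hasProjectiveDimensionLT_monomialSubmodule (g : Fin 4 → Fin d → ℕ) (hg : g 3 ≠ 0)
    (T : Set (Fin d → ℕ)) (hT : ∀ i, ∀ t ∈ T, g i + t ∈ T) (f : Fin d → ℕ) (hf : f ∉ T)
    (hfT : ∀ i, g i + f ∈ T) :
    ¬ HasProjectiveDimensionLT (ModuleCat.of (MvPolynomial (Fin 4) k) (monomialSubmodule k g T hT)) 3 := by
  intro h
  have hT' : ∀ i, ∀ t ∈ insert f T, g i + t ∈ insert f T := by
    rintro i t (rfl | ht)
    · exact Or.inr (hfT i)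
    · exact Or.inr (hT i t ht)
  have hne : ∀ i, ∀ t ∈ insert f T, g i + t ≠ f := by
    rintro i t (rfl | ht) h
    · exact hf (h ▸ hfT i)
    · exact hf (h ▸ hT i t ht)
  have hle : monomialSubmodule k g T hT ≤ monomialSubmodule k g (insert f T) hT' :=
    fun x hx s hs => hx s fun h => hs (Or.inr h)
  -- No generator translates a point of `T ∪ {f}` to `f`, so only the constant term of `r` affects
  -- the coefficient at `f`. That coefficient is therefore a linear map onto the residue field, with
  -- kernel `k[T]`.
  have hsmul : ∀ (r : MvPolynomial (Fin 4) k) (x : ambientModule k g),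
      x ∈ monomialSubmodule k g (insert f T) hT' →
      ambientCoeff (r • x) f = constantCoeff r * ambientCoeff x f := by
    intro r
    induction r using MvPolynomial.induction_on with
    | C c =>
      intro x _
      rw [ambientCoeff_C_smul, constantCoeff_C]
      rfl
    | add p q hp hq =>
      intro x hx
      rw [add_smul, map_add, Finsupp.add_apply, hp x hx, hq x hx, map_add, add_mul]
    | mul_X p i hp =>
      intro x hx
      rw [mul_smul, hp _ (Submodule.smul_mem _ _ hx), map_mul, constantCoeff_X, mul_zero, zero_mul]
      by_cases ht : ∃ t, g i + t = f
      · obtain ⟨t, ht⟩ := ht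
        rw [← ht, ambientCoeff_X_smul_add, hx t fun h => hne i t h ht, mul_zero]
      · push Not at ht
        rw [ambientCoeff_X_smul_eq_zero i x f ht, mul_zero]
  let π : monomialSubmodule k g (insert f T) hT' →ₗ[MvPolynomial (Fin 4) k] residueModule k 4 :=
    { toFun := fun x => (show k from ambientCoeff (x : ambientModule k g) f)
      map_add' := fun x y => by
        rw [Submodule.coe_add, map_add]
        rfl
      map_smul' := fun r x => hsmul r x x.2 }
  have hexact : Function.Exact (Submodule.inclusion hle) π := by
    intro x
    constructor
    · intro hx
      refine ⟨⟨x, fun s hs => ?_⟩, rfl⟩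
      by_cases hsf : s = f
      · rw [hsf]
        exact hx
      · exact x.2 s fun h => h.elim hsf hs
    · rintro ⟨y, rfl⟩
      exact y.2 f hf
  have hsurj : ∀ c : k, ∃ x : monomialSubmodule k g (insert f T) hT',
      ambientCoeff (x : ambientModule k g) f = c := by
    intro c
    refine ⟨⟨ambientCoeff.symm (Finsupp.single f c), fun s hs => ?_⟩, ?_⟩
    · rw [AddEquiv.apply_symm_apply, Finsupp.single_eq_of_ne]
      rintro rfl
      exact hs (Set.mem_insert _ _)
    · rw [AddEquiv.apply_symm_apply, Finsupp.single_eq_same]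
  have hS : (ModuleCat.shortComplexOfCompEqZero _ _ hexact.linearMap_comp_eq_zero).ShortExact :=
    { exact := ModuleCat.shortComplex_exact _ hexact
      mono_f := (ModuleCat.mono_iff_injective _).mpr (Submodule.inclusion_injective hle)
      epi_g := (ModuleCat.epi_iff_surjective _).mpr hsurj }
  exact not_hasProjectiveDimensionLT_residueModule (k := k) (n := 4) (hS.hasProjectiveDimensionLT_X₃ 3 h
    (hasProjectiveDimensionLE_monomialSubmodule g hg _ hT'))

/-- The semigroup ring `k[S]` is spanned by the monomials with exponents in `S`. -/
theorem nonempty_linearEquiv_semigroupRingModule (S : AddSubmonoid (Fin d → ℕ)) (g : Fin n → S)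
    (hS : ∀ i, ∀ t ∈ (S : Set (Fin d → ℕ)), (g i : Fin d → ℕ) + t ∈ (S : Set (Fin d → ℕ))) :
    Nonempty (semigroupRingModule k S g ≃ₗ[MvPolynomial (Fin n) k]
      monomialSubmodule k (fun i => (g i : Fin d → ℕ)) S hS) := by
  let ι : AddMonoidAlgebra k S →ₐ[k] AddMonoidAlgebra k (Fin d → ℕ) :=
    AddMonoidAlgebra.mapDomainAlgHom k k S.subtype
  have hι : ι.comp (presentation k S g) =
      aeval fun i => AddMonoidAlgebra.single (g i : Fin d → ℕ) (1 : k) := by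
    ext i
    simp [ι, presentation]
  let L : semigroupRingModule k S g →ₗ[MvPolynomial (Fin n) k]
      ambientModule k fun i => (g i : Fin d → ℕ) :=
    { toFun := fun x => ι x
      map_add' := fun x y => map_add ι x y
      map_smul' := fun r x => by
        have h := map_mul ι (presentation k S g r) x
        rwa [← AlgHom.comp_apply, hι] at h }
  have hcoeff : ∀ x, ambientCoeff (L x) =
      Finsupp.mapDomain Subtype.val (show AddMonoidAlgebra k S from x).coeff := fun x => rfl
  have hL : ∀ x, L x ∈ monomialSubmodule k (fun i => (g i : Fin d → ℕ)) S hS := by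
    intro x s hs
    rw [hcoeff]
    exact Finsupp.mapDomain_of_notMem_range _ _ (by simpa using hs)
  refine ⟨LinearEquiv.ofBijective (L.codRestrict _ hL) ⟨?_, ?_⟩⟩
  · intro x y hxy
    exact AddMonoidAlgebra.mapDomain_injective Subtype.val_injective (congrArg Subtype.val hxy)
  · rintro ⟨y, hy⟩
    obtain ⟨x, hx⟩ := (Finsupp.mem_range_mapDomain_iff (Subtype.val : S → Fin d → ℕ)
      Subtype.val_injective (ambientCoeff y)).mpr fun s hs => hy s (by simpa using hs)
    refine ⟨AddMonoidAlgebra.ofCoeff x, Subtype.ext (ambientCoeff.injective ?_)⟩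
    exact hx

/-- A semigroup with four generators and a pseudo-Frobenius element has a semigroup ring of
projective dimension `3`. -/
theorem projectiveDimension_semigroupRingModule_of_pseudoFrobenius (S : AddSubmonoid (Fin d → ℕ))
    (g : Fin 4 → S) (hg : ∀ i, (g i : Fin d → ℕ) ≠ 0) {f : Fin d → ℕ}
    (hf : f ∈ pseudoFrobenius S) : projectiveDimension (semigroupRingModule k S g) = 3 := by
  have hS : ∀ i, ∀ t ∈ (S : Set (Fin d → ℕ)), (g i : Fin d → ℕ) + t ∈ (S : Set (Fin d → ℕ)) :=
    fun i t ht => S.add_mem (g i).2 ht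
  obtain ⟨e⟩ := nonempty_linearEquiv_semigroupRingModule (k := k) S g hS
  rw [projectiveDimension_eq_of_iso (Y := ModuleCat.of _ _) e.toModuleIso]
  refine le_antisymm ?_ ?_
  · exact (projectiveDimension_le_iff _ 3).mpr
      (hasProjectiveDimensionLE_monomialSubmodule _ (hg 3) _ _)
  · exact (projectiveDimension_ge_iff _ 3).mpr
      (not_hasProjectiveDimensionLT_monomialSubmodule _ (hg 3) _ _ f hf.1.2 fun i => by
        rw [add_comm]
        exact hf.2 _ (g i).2 (hg i))

end AffineSemigroup

/-! ### Combinatorics of `S_{a,p}`. -/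

namespace AffineSemigroup

theorem vec_two_ext {x y : Fin 2 → ℕ} (h0 : x 0 = y 0) (h1 : x 1 = y 1) : x = y := by
  ext i
  fin_cases i <;> assumption

/-- `S_{a,p}` consists of the points `m (2, 2) + i (a, 0) + j (0, a ^ p)` with `m ≤ i + j`. -/
theorem mem_Sap_iff {a p : ℕ} {x : Fin 2 → ℕ} :
    x ∈ Sap a p ↔ ∃ m i j : ℕ, m ≤ i + j ∧ x 0 = 2 * m + a * i ∧ x 1 = 2 * m + a ^ p * j := by
  constructor
  · intro hx
    induction hx using AddSubmonoid.closure_induction with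
    | mem x hx =>
      rcases hx with rfl | rfl | rfl | rfl
      · exact ⟨0, 1, 0, by simp⟩
      · exact ⟨0, 0, 1, by simp⟩
      · exact ⟨1, 1, 0, by simp [add_comm]⟩
      · exact ⟨1, 0, 1, by simp⟩
    | zero => exact ⟨0, 0, 0, by simp⟩
    | add x y _ _ hx hy =>
      obtain ⟨m, i, j, h, h0, h1⟩ := hx
      obtain ⟨m', i', j', h', h0', h1'⟩ := hy
      refine ⟨m + m', i + i', j + j', by omega, ?_, ?_⟩
      · rw [Pi.add_apply, h0, h0']
        ring
      · rw [Pi.add_apply, h1, h1']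
        ring
  · rintro ⟨m, i, j, h, h0, h1⟩
    -- Each copy of `(2, 2)` is attached to a copy of `(a, 0)` while these last, then to a copy of
    -- `(0, a ^ p)`.
    obtain ⟨α, α', β, β', rfl, rfl, rfl⟩ : ∃ α α' β β', m = α + α' ∧ i = α + β ∧ j = α' + β' :=
      ⟨min m i, m - min m i, i - min m i, j - (m - min m i), by omega, by omega, by omega⟩
    have hx : x = α • ![a + 2, 2] + α' • ![2, 2 + a ^ p] + β • ![a, 0] + β' • ![0, a ^ p] := by
      apply vec_two_ext
      · simp only [h0, Pi.add_apply, Pi.smul_apply, Matrix.cons_val_zero, smul_eq_mul]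
        ring
      · simp only [h1, Pi.add_apply, Pi.smul_apply, Matrix.cons_val_one, Matrix.cons_val_fin_one, smul_eq_mul]
        ring
    rw [hx]
    refine add_mem (add_mem (add_mem ?_ ?_) ?_) ?_ <;>
      exact nsmul_mem (AddSubmonoid.subset_closure (by simp)) _

theorem pow_eq_mul_pow_pred {a p : ℕ} (hp : 1 ≤ p) : a ^ p = a * a ^ (p - 1) := by
  rw [← pow_succ', Nat.sub_add_cancel hp]

/-- Among the representations `m (2, 2) + i (a, 0) + j (0, a ^ p)` of a point, the one with
`m < a ^ p` has the smallest `m` and the largest `i` and `j`. -/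
theorem exists_eq_of_repr_eq {a p m i j m' i' j' : ℕ} (ha : Odd a) (hp : 1 ≤ p) (hm : m < a ^ p)
    (h0 : 2 * m + a * i = 2 * m' + a * i') (h1 : 2 * m + a ^ p * j = 2 * m' + a ^ p * j') :
    ∃ c, m' = m + a ^ p * c ∧ i = i' + 2 * a ^ (p - 1) * c ∧ j = j' + 2 * c := by
  have hq : Odd (a ^ p) := ha.pow
  have hqa : a ^ p = a * a ^ (p - 1) := pow_eq_mul_pow_pred hp
  -- The second coordinate alone determines `m` modulo the odd number `a ^ p`.
  have hmod : 2 * m ≡ 2 * m' [MOD a ^ p] := by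
    have h : 2 * m + a ^ p * j ≡ 2 * m' + a ^ p * j' [MOD a ^ p] := by rw [h1]
    simpa [Nat.ModEq] using h
  have hmod' : m ≡ m' [MOD a ^ p] :=
    Nat.ModEq.cancel_left_of_coprime (Nat.Coprime.symm hq.coprime_two_left) hmod
  have hm' : m' = m + a ^ p * (m' / a ^ p) := by
    have h := Nat.mod_add_div m' (a ^ p)
    rw [← hmod', Nat.mod_eq_of_lt hm] at h
    exact h.symm
  obtain ⟨c, hc⟩ : ∃ c, m' = m + a ^ p * c := ⟨_, hm'⟩
  refine ⟨c, hc, ?_, ?_⟩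
  · apply Nat.eq_of_mul_eq_mul_left ha.pos
    rw [hc, hqa] at h0
    linarith
  · apply Nat.eq_of_mul_eq_mul_left hq.pos
    rw [hc] at h1
    linarith

variable {a p : ℕ}

theorem three_le_pow (ha3 : 3 ≤ a) (hp : 1 ≤ p) : 3 ≤ a ^ p :=
  ha3.trans (Nat.le_self_pow (by omega) a)

theorem apery_Sap (ha : Odd a) (hp : 1 ≤ p) :
    apery (Sap a p) {![a, 0], ![0, a ^ p]} =
      {x | ∃ α α' : ℕ, α + α' < a ^ p ∧ x = α • ![a + 2, 2] + α' • ![2, 2 + a ^ p]} := by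
  ext x
  constructor
  · rintro ⟨hx, hE⟩
    obtain ⟨m, i, j, h, h0, h1⟩ := mem_Sap_iff.mp hx
    have hx1 : ∀ m' i' j', m' ≤ i' + j' → x 0 = 2 * m' + a * (i' + 1) →
        x 1 = 2 * m' + a ^ p * j' → False := by
      intro m' i' j' h' h0' h1'
      refine hE ![a, 0] (by simp) ⟨![2 * m' + a * i', 2 * m' + a ^ p * j'],
        mem_Sap_iff.mpr ⟨m', i', j', h', rfl, rfl⟩, vec_two_ext ?_ ?_⟩
      · rw [h0']
        change 2 * m' + a * i' + a = _
        ring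
      · rw [h1']
        rfl
    have hx2 : ∀ m' i' j', m' ≤ i' + j' → x 0 = 2 * m' + a * i' →
        x 1 = 2 * m' + a ^ p * (j' + 1) → False := by
      intro m' i' j' h' h0' h1'
      refine hE ![0, a ^ p] (by simp) ⟨![2 * m' + a * i', 2 * m' + a ^ p * j'],
        mem_Sap_iff.mpr ⟨m', i', j', h', rfl, rfl⟩, vec_two_ext ?_ ?_⟩
      · rw [h0']
        rfl
      · rw [h1']
        change 2 * m' + a ^ p * j' + a ^ p = _
        ring
    -- With slack `m < i + j`, some axis generator could be subtracted.
    have hm : m = i + j := by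
      by_contra hne
      rcases Nat.eq_zero_or_pos i with rfl | hi
      · obtain ⟨j, rfl⟩ := Nat.exists_eq_succ_of_ne_zero (show j ≠ 0 by omega)
        exact hx2 m 0 j (by omega) h0 h1
      · obtain ⟨i, rfl⟩ := Nat.exists_eq_succ_of_ne_zero hi.ne'
        exact hx1 m i j (by omega) h0 h1
    have hlt : m < a ^ p := by
      by_contra hge
      obtain ⟨r, hr⟩ := Nat.exists_eq_add_of_le (not_lt.mp hge)
      -- Trading `a ^ p` copies of `(2, 2)` by the basic relation yields two copies of `(0, a ^ p)`,
      -- one of which is subtracted.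
      refine hx2 r (i + 2 * a ^ (p - 1)) (j + 1) (by omega) ?_ ?_
      · have := pow_eq_mul_pow_pred (a := a) hp
        rw [h0, hr]
        linear_combination 2 * this
      · rw [h1, hr]
        ring
    refine ⟨i, j, hm ▸ hlt, vec_two_ext ?_ ?_⟩
    · simp only [h0, hm, Pi.add_apply, Pi.smul_apply, Matrix.cons_val_zero, smul_eq_mul]
      ring
    · simp only [h1, hm, Pi.add_apply, Pi.smul_apply, Matrix.cons_val_one, Matrix.cons_val_fin_one, smul_eq_mul]
      ring
  · rintro ⟨α, α', hlt, rfl⟩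
    have h0 : (α • ![a + 2, 2] + α' • ![2, 2 + a ^ p] : Fin 2 → ℕ) 0 =
        2 * (α + α') + a * α := by
      simp only [Pi.add_apply, Pi.smul_apply, Matrix.cons_val_zero, smul_eq_mul]
      ring
    have h1 : (α • ![a + 2, 2] + α' • ![2, 2 + a ^ p] : Fin 2 → ℕ) 1 =
        2 * (α + α') + a ^ p * α' := by
      simp only [Pi.add_apply, Pi.smul_apply, Matrix.cons_val_one, Matrix.cons_val_fin_one, smul_eq_mul]
      ring
    refine ⟨mem_Sap_iff.mpr ⟨α + α', α, α', le_rfl, h0, h1⟩, ?_⟩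
    -- Here `i'`, `j'` include the subtracted generator. The reduced representation has the least
    -- `m` and the largest sum, so `i' + j' ≤ α + α' ≤ m ≤ i + j`.
    have key : ∀ m i j i' j' : ℕ, m ≤ i + j → i + j < i' + j' →
        2 * (α + α') + a * α = 2 * m + a * i' →
        2 * (α + α') + a ^ p * α' = 2 * m + a ^ p * j' → False := by
      intro m i j i' j' h hlt' e0 e1
      obtain ⟨c, hc, hi, hj⟩ := exists_eq_of_repr_eq ha hp hlt e0 e1
      have := Nat.zero_le (a ^ p * c)
      have := Nat.zero_le (2 * a ^ (p - 1) * c)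
      omega
    rintro e he ⟨s, hs, hse⟩
    obtain ⟨m, i, j, h, hs0, hs1⟩ := mem_Sap_iff.mp hs
    have e0 := congrFun hse 0
    have e1 := congrFun hse 1
    rw [h0, Pi.add_apply, hs0] at e0
    rw [h1, Pi.add_apply, hs1] at e1
    rcases he with rfl | rfl
    · refine key m i j (i + 1) j h (by omega) (e0.symm.trans ?_) (e1.symm.trans ?_)
      · simp only [Matrix.cons_val_zero]
        ring
      · simp
    · refine key m i j i (j + 1) h (by omega) (e0.symm.trans ?_) (e1.symm.trans ?_)
      · simp
      · simp only [Matrix.cons_val_one, Matrix.cons_val_fin_one]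
        ring

/-- This form displays the reduced representation: `m = a ^ p - 1`, `i = a ^ p - 2 - l`, `j = l`. -/
theorem mem_Delta_iff (ha3 : 3 ≤ a) (hp : 1 ≤ p) {x : Fin 2 → ℕ} :
    x ∈ Delta a p ↔ ∃ l < a ^ p - 1,
      ![2 * (a ^ p - 1) + a * (a ^ p - 2 - l), 2 * (a ^ p - 1) + a ^ p * l] = x := by
  have hq := three_le_pow ha3 hp
  have key : ∀ l, l < a ^ p - 1 →
      ((2 * (a ^ p - 1) + a * (a ^ p - 2 - l) : ℕ) : ℤ) =
          (a : ℤ) ^ p * (a + 2) - (l + 2) * a - 2 ∧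
        ((2 * (a ^ p - 1) + a ^ p * l : ℕ) : ℤ) = (a : ℤ) ^ p * (l + 2) - 2 := by
    intro l hl
    obtain ⟨r, hr⟩ := Nat.exists_eq_add_of_le (show l + 2 ≤ a ^ p by omega)
    have h1 : a ^ p - 1 = l + 1 + r := by omega
    have h2 : a ^ p - 2 - l = r := by omega
    have hr' : (a : ℤ) ^ p = l + 2 + r := by exact_mod_cast hr
    rw [h1, h2]
    push_cast
    rw [hr']
    constructor <;> ring
  constructor
  · rintro ⟨l, hl, h0, h1⟩
    have hl' : l < a ^ p - 1 := by
      have : ((l + 1 : ℕ) : ℤ) < ((a ^ p : ℕ) : ℤ) := by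
        push_cast
        linarith
      have := Int.ofNat_lt.mp this
      omega
    refine ⟨l, hl', vec_two_ext ?_ ?_⟩
    · exact Int.ofNat_inj.mp ((key l hl').1.trans h0.symm)
    · exact Int.ofNat_inj.mp ((key l hl').2.trans h1.symm)
  · rintro ⟨l, hl, rfl⟩
    refine ⟨l, ?_, (key l hl).1, (key l hl).2⟩
    have : ((l + 1 : ℕ) : ℤ) < ((a ^ p : ℕ) : ℤ) := by
      rw [Int.ofNat_lt]
      omega
    push_cast at this
    linarith

theorem encard_Delta (ha3 : 3 ≤ a) (hp : 1 ≤ p) :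
    (Delta a p).encard = ((a ^ p - 1 : ℕ) : ℕ∞) := by
  have hq := three_le_pow ha3 hp
  have h : Delta a p = (fun l : ℕ =>
      ![2 * (a ^ p - 1) + a * (a ^ p - 2 - l), 2 * (a ^ p - 1) + a ^ p * l]) ''
        (Finset.range (a ^ p - 1) : Set ℕ) := by
    ext x
    rw [mem_Delta_iff ha3 hp]
    simp
  rw [h, Function.Injective.encard_image, Set.encard_coe_eq_coe_finsetCard, Finset.card_range]
  intro l l' hl
  have h1 := congrFun hl 1
  simp only [Matrix.cons_val_one, Matrix.cons_val_fin_one, add_right_inj] at h1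
  exact Nat.eq_of_mul_eq_mul_left (by omega) h1

/-- The generators on the axes already span the whole quadrant, so every point outside `S` is a gap.
-/
theorem mem_cone_Sap (ha : 0 < a) (x : Fin 2 → ℕ) : (fun i => (x i : ℚ)) ∈ cone (Sap a p) := by
  have hq : 0 < a ^ p := pow_pos ha p
  have hmem : ∀ s ∈ Sap a p, (fun i => (s i : ℚ)) ∈ cone (Sap a p) :=
    fun s hs => Submodule.subset_span ⟨s, hs, rfl⟩
  have h1 := hmem ![a, 0] (AddSubmonoid.subset_closure (by simp))
  have h2 := hmem ![0, a ^ p] (AddSubmonoid.subset_closure (by simp))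
  have h := add_mem (Submodule.smul_mem _ ((x 0 : ℚ≥0) / a) h1)
    (Submodule.smul_mem _ ((x 1 : ℚ≥0) / (a ^ p : ℕ)) h2)
  convert h using 1
  have ha' : (a : ℚ) ≠ 0 := by exact_mod_cast ha.ne'
  ext i
  fin_cases i
  · simp [NNRat.smul_def, ha']
  · simp [NNRat.smul_def, ha']

theorem Delta_subset_pseudoFrobenius (ha3 : 3 ≤ a) (ha : Odd a) (hp : 1 ≤ p) :
    Delta a p ⊆ pseudoFrobenius (Sap a p) := by
  intro x hx
  have hq := three_le_pow ha3 hp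
  obtain ⟨l, hl, rfl⟩ := (mem_Delta_iff ha3 hp).mp hx
  refine ⟨⟨mem_cone_Sap ha.pos _, fun hmem => ?_⟩, fun s hs hs0 => ?_⟩
  · obtain ⟨m, i, j, h, h0, h1⟩ := mem_Sap_iff.mp hmem
    obtain ⟨c, hc, hi, hj⟩ := exists_eq_of_repr_eq ha hp (by omega) h0 h1
    have := Nat.zero_le (a ^ p * c)
    have := Nat.zero_le (2 * a ^ (p - 1) * c)
    omega
  · obtain ⟨m, i, j, h, h0, h1⟩ := mem_Sap_iff.mp hs
    rw [mem_Sap_iff]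
    -- If `s` has `m = 0`, it raises `i + j` by at least the missing one. Otherwise the total of `m`
    -- reaches `a ^ p`, and the basic relation lowers it while enlarging `i` and `j`.
    rcases Nat.eq_zero_or_pos m with rfl | hm
    · have hij : 1 ≤ i + j := by
        by_contra hij
        obtain ⟨rfl, rfl⟩ : i = 0 ∧ j = 0 := by omega
        exact hs0 (vec_two_ext (by simpa using h0) (by simpa using h1))
      refine ⟨a ^ p - 1, a ^ p - 2 - l + i, l + j, by omega, ?_, ?_⟩
      · rw [Pi.add_apply, h0]
        simp only [Matrix.cons_val_zero]
        ring
      · rw [Pi.add_apply, h1]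
        simp only [Matrix.cons_val_one, Matrix.cons_val_fin_one]
        ring
    · obtain ⟨m, rfl⟩ := Nat.exists_eq_add_of_lt hm
      rw [zero_add] at h h0 h1
      have hsum : 2 * (a ^ p - 1) + 2 * (m + 1) = 2 * m + 2 * a ^ p := by omega
      have hqa := pow_eq_mul_pow_pred (a := a) hp
      refine ⟨m, a ^ p - 2 - l + i + 2 * a ^ (p - 1), l + j + 2, by omega, ?_, ?_⟩
      · rw [Pi.add_apply, h0]
        simp only [Matrix.cons_val_zero]
        linear_combination hsum + 2 * hqa
      · rw [Pi.add_apply, h1]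
        simp only [Matrix.cons_val_one, Matrix.cons_val_fin_one]
        linear_combination hsum

theorem minimalGenerators_Sap (ha3 : 3 ≤ a) (hp : 1 ≤ p) :
    minimalGenerators (Sap a p) = {![a, 0], ![0, a ^ p], ![a + 2, 2], ![2, 2 + a ^ p]} := by
  refine (minimalGenerators_subset rfl).antisymm fun x hx => ?_
  have hq := three_le_pow ha3 hp
  have hxS : x ∈ Sap a p := AddSubmonoid.subset_closure hx
  refine ⟨hxS, ?_, fun y hy z hz hyz => ?_⟩
  · rintro rfl
    rcases hx with h | h | h | h
    · have := congrFun h 0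
      simp at this
      omega
    · have := congrFun h 1
      simp at this
      omega
    · have := congrFun h 0
      simp at this
    · have := congrFun h 0
      simp at this
  obtain ⟨m, i, j, h, h0, h1⟩ := mem_Sap_iff.mp hy
  obtain ⟨m', i', j', h', h0', h1'⟩ := mem_Sap_iff.mp hz
  have zero_of : ∀ {w : Fin 2 → ℕ} {m i j : ℕ}, w 0 = 2 * m + a * i → w 1 = 2 * m + a ^ p * j →
      m ≤ i + j → i = 0 ∧ j = 0 → w = 0 := by
    rintro w m i j h0 h1 h ⟨rfl, rfl⟩
    obtain rfl : m = 0 := by omega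
    exact vec_two_ext h0 h1
  -- The sum `i + j` is additive and equals `1` on generators; a summand with `i + j = 0` also has
  -- `m = 0`.
  suffices hs : i + i' + (j + j') = 1 by
    rcases (show (i = 0 ∧ j = 0) ∨ (i' = 0 ∧ j' = 0) by omega) with hw | hw
    · exact Or.inl (zero_of h0 h1 h hw)
    · exact Or.inr (zero_of h0' h1' h' hw)
  have e0 : 2 * (m + m') + a * (i + i') = x 0 := by
    rw [← hyz, Pi.add_apply, h0, h0']
    ring
  have e1 : 2 * (m + m') + a ^ p * (j + j') = x 1 := by
    rw [← hyz, Pi.add_apply, h1, h1']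
    ring
  have hbound : ∀ {b t c : ℕ}, 3 ≤ b → b * t ≤ c → c < 3 → t = 0 := by
    intro b t c hb hbt hc
    rcases Nat.eq_zero_or_pos t with ht | ht
    · exact ht
    · have := Nat.le_mul_of_pos_right b ht
      omega
  have hone : ∀ {b t : ℕ}, 3 ≤ b → b * t = b → t = 1 := by
    intro b t hb hbt
    exact Nat.eq_of_mul_eq_mul_left (by omega) (hbt.trans (mul_one b).symm)
  rcases hx with rfl | rfl | rfl | rfl
  · simp only [Matrix.cons_val_zero, Matrix.cons_val_one] at e0 e1
    have hj := hbound hq (Nat.le_of_eq (show a ^ p * (j + j') = 0 by omega)) (by omega)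
    have hi := hone ha3 (show a * (i + i') = a by omega)
    omega
  · simp only [Matrix.cons_val_zero, Matrix.cons_val_one] at e0 e1
    have hi := hbound ha3 (Nat.le_of_eq (show a * (i + i') = 0 by omega)) (by omega)
    have hj := hone hq (show a ^ p * (j + j') = a ^ p by omega)
    omega
  · simp only [Matrix.cons_val_zero, Matrix.cons_val_one] at e0 e1
    have hj := hbound hq (show a ^ p * (j + j') ≤ 2 by omega) (by omega)
    rw [hj, mul_zero] at e1
    have hi := hone ha3 (show a * (i + i') = a by omega)
    omega
  · simp only [Matrix.cons_val_zero, Matrix.cons_val_one] at e0 e1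
    have hi := hbound ha3 (show a * (i + i') ≤ 2 by omega) (by omega)
    rw [hi, mul_zero] at e0
    have hj := hone hq (show a ^ p * (j + j') = a ^ p by omega)
    omega

/-- The generators of `S_{a,p}`, as a family. -/
def SapGenerators (a p : ℕ) : Fin 4 → Fin 2 → ℕ :=
  ![![a + 2, 2], ![2, 2 + a ^ p], ![a, 0], ![0, a ^ p]]

theorem SapGenerators_injective (ha3 : 3 ≤ a) (hp : 1 ≤ p) :
    Function.Injective (SapGenerators a p) := by
  have hq := three_le_pow ha3 hp
  intro i j hij
  have h0 := congrFun hij 0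
  have h1 := congrFun hij 1
  fin_cases i <;> fin_cases j <;> simp [SapGenerators] at h0 h1 ⊢ <;> omega

theorem range_SapGenerators (ha3 : 3 ≤ a) (hp : 1 ≤ p) :
    Set.range (SapGenerators a p) = minimalGenerators (Sap a p) := by
  rw [minimalGenerators_Sap ha3 hp]
  ext x
  simp only [SapGenerators, Set.mem_range, Fin.exists_fin_succ, Set.mem_insert_iff,
    Set.mem_singleton_iff]
  simp [eq_comm]
  tauto

theorem embeddingDim_Sap (ha3 : 3 ≤ a) (hp : 1 ≤ p) : embeddingDim (Sap a p) = 4 := by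
  rw [embeddingDim, ← range_SapGenerators ha3 hp, ← Set.image_univ,
    (SapGenerators_injective ha3 hp).encard_image]
  simp

theorem isMPD_Sap (k : Type u) [Field k] (ha3 : 3 ≤ a) (ha : Odd a) (hp : 1 ≤ p) :
    IsMPD k (Sap a p) := by
  have hmem : ∀ i, SapGenerators a p i ∈ minimalGenerators (Sap a p) := fun i =>
    range_SapGenerators ha3 hp ▸ Set.mem_range_self i
  have hq := three_le_pow ha3 hp
  -- Any one pseudo-Frobenius element suffices; this is the point of `Δ` with `ℓ = 0`.
  have hΔ := (mem_Delta_iff ha3 hp).mpr ⟨0, (by omega : 0 < a ^ p - 1), rfl⟩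
  refine ⟨4, fun i => ⟨SapGenerators a p i, (hmem i).1⟩, ?_, ?_, ?_⟩
  · exact fun i j hij => SapGenerators_injective ha3 hp (congrArg Subtype.val hij)
  · exact (isMinimalGeneratingSet_iff _ _).mpr (range_SapGenerators ha3 hp)
  · rw [projectiveDimension_semigroupRingModule_of_pseudoFrobenius (Sap a p) _
      (fun i => (hmem i).2.1) (Delta_subset_pseudoFrobenius ha3 ha hp hΔ)]
    rfl

theorem le_bettiType_Sap (ha3 : 3 ≤ a) (ha : Odd a) (hp : 1 ≤ p) :
    ((a ^ p - 1 : ℕ) : ℕ∞) ≤ bettiType (Sap a p) :=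
  encard_Delta ha3 hp ▸ Set.encard_le_encard (Delta_subset_pseudoFrobenius ha3 ha hp)

end AffineSemigroup


theorem mainTheorem4 (k : Type*) [Field k] :
    (∀ a p : ℕ, 3 ≤ a → Odd a → 1 ≤ p →
      AffineSemigroup.apery (AffineSemigroup.Sap a p) {![a, 0], ![0, a ^ p]} =
          {x | ∃ α α' : ℕ, α + α' < a ^ p ∧ x = α • ![a + 2, 2] + α' • ![2, 2 + a ^ p]} ∧
        AffineSemigroup.IsMPD k (AffineSemigroup.Sap a p) ∧
        AffineSemigroup.Delta a p ⊆ AffineSemigroup.pseudoFrobenius (AffineSemigroup.Sap a p) ∧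
        (AffineSemigroup.Delta a p).encard = ((a ^ p - 1 : ℕ) : ℕ∞) ∧
        ((a ^ p - 1 : ℕ) : ℕ∞) ≤ AffineSemigroup.bettiType (AffineSemigroup.Sap a p) ∧
        AffineSemigroup.embeddingDim (AffineSemigroup.Sap a p) = 4) ∧
    (∀ N : ℕ, ∃ a p : ℕ, 3 ≤ a ∧ Odd a ∧ 1 ≤ p ∧
      AffineSemigroup.IsMPD k (AffineSemigroup.Sap a p) ∧
      AffineSemigroup.embeddingDim (AffineSemigroup.Sap a p) = 4 ∧
      (N : ℕ∞) ≤ AffineSemigroup.bettiType (AffineSemigroup.Sap a p)) := by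
  open AffineSemigroup in
  refine ⟨fun a p ha3 ha hp => ⟨apery_Sap ha hp, isMPD_Sap k ha3 ha hp,
    Delta_subset_pseudoFrobenius ha3 ha hp, encard_Delta ha3 hp, le_bettiType_Sap ha3 ha hp,
    embeddingDim_Sap ha3 hp⟩, fun N => ?_⟩
  have h3 : Odd 3 := by decide
  -- Fixing `a = 3` is enough, since `3 ^ (N + 1) - 1 ≥ N`.
  refine ⟨3, N + 1, le_rfl, h3, by omega, AffineSemigroup.isMPD_Sap k le_rfl h3 (by omega),
    AffineSemigroup.embeddingDim_Sap le_rfl (by omega),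
    le_trans ?_ (AffineSemigroup.le_bettiType_Sap le_rfl h3 (by omega))⟩
  have h : N + 1 < 3 ^ (N + 1) := Nat.lt_pow_self (by norm_num)
  exact_mod_cast (show N ≤ 3 ^ (N + 1) - 1 by omega)
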